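/- Let $M$ be a compact (Hausdorff) smooth surface with nonempty boundary $\partial M$, let $g_0$ be a smooth Riemannian metric on $M$, let $f\in C^\infty(M)$, and let $g=e^{2f}g_0$. For $\varphi\in C^1(M)$ ($C^1$ up to the boundary) that does not vanish identically on $\partial M$, put $$Q_g(\varphi)=\frac{\int_M|\nabla\varphi|_g^2\,dv_g}{\int_{\partial M}\varphi^2\,d\sigma_g},$$ where $dv_g$ is the area measure and $d\sigma_g$ the boundary length measure of $g$, and define $Q_{g_0}(\varphi)$ likewise. Let $K=\max_{\partial M}e^{-f}$, and consider the inequality $$Q_g(\varphi)\ \ge\ K\,Q_{g_0}(\varphi).\qquad(*)$$ Then the following hold, where $\varphi$ always denotes a function in $C^1(M)$ that is not identically zero on $\partial M$. 1. If $(*)$ holds for $\varphi$, then it is an equality: $Q_g(\varphi)=K\,Q_{g_0}(\varphi)$. 2. If $(*)$ holds for some $\varphi$ with $\nabla\varphi\not\equiv0$, then $e^{-f(x)}=K$ at every $x\in\partial M$ with $\varphi(x)\ne0$. 3. If $(*)$ holds for every $\varphi$ with $\nabla\varphi\not\equiv0$, then $f$ is constant on $\partial M$. 4. If $f$ is constant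 on $\partial M$, then $Q_g(\varphi)=K\,Q_{g_0}(\varphi)$ for every $\varphi$. 5. If $f$ is not constant on $\partial M$, then there is $\varphi$ with $\nabla\varphi\not\equiv0$ and $Q_g(\varphi)\ne K\,Q_{g_0}(\varphi)$. 6. Suppose that $M$ is connected, and let $\nu_1(g)$ be the first nonzero Steklov eigenvalue of $(M,g)$ in its variational form, that is, the infimum of $Q_g(\varphi)$ over all $\varphi$ with $\int_{\partial M}\varphi\,d\sigma_g=0$. If $\nu_1(g)\ge K\,\nu_1(g_0)$, then $\nu_1(g)=K\,\nu_1(g_0)$; so this bound is never strict. -/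

import Mathlib

open Set MeasureTheory Manifold Bundle
open scoped ContDiff

noncomputable section

namespace SteklovSurface

/-- Smooth Riemannian metrics on a surface `M` with boundary. -/
abbrev Metric (M : Type*) [TopologicalSpace M] [ChartedSpace (EuclideanHalfSpace 2) M]
    [IsManifold (𝓡∂ 2) ∞ M] :=
  ContMDiffRiemannianMetric (𝓡∂ 2) ∞ (EuclideanSpace ℝ (Fin 2))
    (fun x : M => TangentSpace (𝓡∂ 2) x)

section

variable {M : Type*} [TopologicalSpace M] [ChartedSpace (EuclideanHalfSpace 2) M]
  [IsManifold (𝓡∂ 2) ∞ M]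

instance (x : M) : FiniteDimensional ℝ (TangentSpace (𝓡∂ 2) x) :=
  inferInstanceAs (FiniteDimensional ℝ (EuclideanSpace ℝ (Fin 2)))

/-- The musical map `v ↦ g(v, ·)` from the tangent space to its dual. -/
def flat (g : Metric M) (x : M) :
    TangentSpace (𝓡∂ 2) x →ₗ[ℝ] Module.Dual ℝ (TangentSpace (𝓡∂ 2) x) where
  toFun v := (g.inner x v).toLinearMap
  map_add' v w := by ext; simp
  map_smul' c v := by ext; simp

theorem flat_injective (g : Metric M) (x : M) : Function.Injective (flat g x) := by
  refine (injective_iff_map_eq_zero _).2 fun v hv => ?_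
  by_contra hne
  have h := g.pos x v hne
  have h0 : flat g x v v = 0 := by rw [hv]; rfl
  have h1 : g.inner x v v = 0 := h0
  exact h.ne' h1

/-- The musical isomorphism between the tangent space and its dual. -/
def flatEquiv (g : Metric M) (x : M) :
    TangentSpace (𝓡∂ 2) x ≃ₗ[ℝ] Module.Dual ℝ (TangentSpace (𝓡∂ 2) x) :=
  (flat g x).linearEquivOfInjective (flat_injective g x) Subspace.dual_finrank_eq.symm

/-- The differential of a real function at `x`, as a linear form on the tangent space. -/
def differential (φ : M → ℝ) (x : M) : Module.Dual ℝ (TangentSpace (𝓡∂ 2) x) :=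
  (mfderiv (𝓡∂ 2) 𝓘(ℝ, ℝ) φ x : TangentSpace (𝓡∂ 2) x →L[ℝ] ℝ).toLinearMap

/-- The gradient of `φ` with respect to `g`. -/
def gradient (g : Metric M) (φ : M → ℝ) (x : M) : TangentSpace (𝓡∂ 2) x :=
  (flatEquiv g x).symm (differential φ x)

/-- The defining property of the gradient: `g(∇φ, v) = dφ(v)`. -/
theorem inner_gradient (g : Metric M) (φ : M → ℝ) (x : M) (v : TangentSpace (𝓡∂ 2) x) :
    g.inner x (gradient g φ x) v = mfderiv (𝓡∂ 2) 𝓘(ℝ, ℝ) φ x v :=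
  LinearMap.congr_fun ((flatEquiv g x).apply_symm_apply (differential φ x)) v

/-- `|∇φ|²` with respect to `g`. -/
def gradientNormSq (g : Metric M) (φ : M → ℝ) (x : M) : ℝ :=
  g.inner x (gradient g φ x) (gradient g φ x)

/-- The coordinate vector field `∂ᵢ` of the chart around `p`, at a point `m` of the domain of that
chart: the image of the `i`-th standard basis vector under the derivative of the inverse chart
(see
`TangentBundle.symmL_trivializationAt`). -/
def coordVector (p : M) (i : Fin 2) (m : M) : TangentSpace (𝓡∂ 2) m :=
  (trivializationAt (EuclideanSpace ℝ (Fin 2)) (TangentSpace (𝓡∂ 2)) p).symmL ℝ m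
    (EuclideanSpace.single i 1)

/-- The matrix `(gᵢⱼ)` of `g` at `m` in the chart around `p`. -/
def gram (g : Metric M) (p m : M) : Matrix (Fin 2) (Fin 2) ℝ :=
  Matrix.of fun i j => g.inner m (coordVector p i m) (coordVector p j m)

variable [T2Space M] [CompactSpace M]

variable (M) in
/-- A smooth partition of unity subordinate to the chart domains of `M`; it does not depend on
any metric. -/
def chartPartition : SmoothPartitionOfUnity M (𝓡∂ 2) M (univ : Set M) :=
  (SmoothPartitionOfUnity.exists_isSubordinate_chartAt_source (𝓡∂ 2) M).choose

theorem chartPartition_isSubordinate :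
    (chartPartition M).IsSubordinate fun p => (chartAt (EuclideanHalfSpace 2) p).source :=
  (SmoothPartitionOfUnity.exists_isSubordinate_chartAt_source (𝓡∂ 2) M).choose_spec

variable [MeasurableSpace M]

/-- The Riemannian area `dv_g`: the sum over the charts of `ψₚ √(det gᵢⱼ) dx¹dx²`, where `ψₚ` is
the partition of unity. -/
def area (g : Metric M) : Measure M :=
  Measure.sum fun p : M =>
    (((volume : Measure (EuclideanSpace ℝ (Fin 2))).restrict (extChartAt (𝓡∂ 2) p).target).map
      (extChartAt (𝓡∂ 2) p).symm).withDensity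
        fun m => ENNReal.ofReal (chartPartition M p m * √(gram g p m).det)

/-- The Riemannian length `dσ_g` of the boundary, as a measure on `M` carried by `∂M`. In a chart
with values in the half plane `{x⁰ ≥ 0}` the boundary is the line `{x⁰ = 0}` with coordinate
`t = x¹`, and the length element is `√g₁₁ dt`. -/
def boundaryLength (g : Metric M) : Measure M :=
  Measure.sum fun p : M =>
    (((volume : Measure ℝ).restrict {t : ℝ | !₂[(0 : ℝ), t] ∈ (extChartAt (𝓡∂ 2) p).target}).map
      fun t => (extChartAt (𝓡∂ 2) p).symm !₂[(0 : ℝ), t]).withDensity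
        fun m => ENNReal.ofReal (chartPartition M p m * √(gram g p m 1 1))

/-- The Rayleigh quotient `Q_g(φ) = ∫_M |∇φ|² dv_g / ∫_{∂M} φ² dσ_g`. -/
def rayleigh (g : Metric M) (φ : M → ℝ) : ℝ :=
  (∫ x, gradientNormSq g φ x ∂(area g)) / ∫ x, φ x ^ 2 ∂(boundaryLength g)

/-- The functions on which the Rayleigh quotient is considered: `C¹` up to the boundary, and not
identically zero on the boundary. -/
structure IsTest (φ : M → ℝ) : Prop where
  contMDiff : ContMDiff (𝓡∂ 2) 𝓘(ℝ, ℝ) 1 φ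
  ne_zero : ∃ x ∈ (𝓡∂ 2).boundary M, φ x ≠ 0

/-- The first nonzero Steklov eigenvalue of a connected surface, in its variational form: the
infimum of the Rayleigh quotient over the functions with mean zero on the boundary. -/
def firstSteklov (g : Metric M) : ℝ :=
  sInf {q | ∃ φ : M → ℝ, IsTest φ ∧ ∫ x, φ x ∂(boundaryLength g) = 0 ∧ q = rayleigh g φ}

end

end SteklovSurface

end

/-! In dimension two the Dirichlet energy is conformally invariant: `dv_g` gains the factor `e^{2f}`
and `|∇φ|²` loses it (`energy_conformal`). The boundary length only gains `e^f`
(`boundary_integral_conformal`). So the two Rayleigh quotients share a numerator `E` and have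
denominators `∫ e^f φ² dσ₀` and `∫ φ² dσ₀`. Since `K e^f ≥ 1` on `∂M`, the reverse inequality `Q_g ≤
K Q_{g₀}` always holds (`rayleigh_le`), and `(*)` can only be an equality.

If moreover `E > 0`, equality makes the integral of the nonnegative function `(K e^f - 1) φ²`
vanish. As boundary length charges every neighbourhood of a boundary point, this continuous function
is zero on `∂M` (`exp_neg_eq_of_rayleigh_ge`). A positive nonconstant `φ` then forces `e^{-f} = K`
on all of `∂M`.

For eigenvalues, a competitor with `g₀`-mean zero becomes one for `g` after adding a constant. This
keeps the energy and can only increase the `g₀`-square integral, so `ν₁(g) ≤ K ν₁(g₀)`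
(`firstSteklov_le`). -/

namespace SteklovSurface

/-! ### Gradients and Gram matrices in a chart. -/

section Pointwise

variable {M : Type*} [TopologicalSpace M] [ChartedSpace (EuclideanHalfSpace 2) M]

theorem differential_add_const {φ : M → ℝ} (hφ : MDifferentiable (𝓡∂ 2) 𝓘(ℝ, ℝ) φ) (c : ℝ)
    (x : M) : differential (fun y => φ y + c) x = differential φ x := by
  have h := mfderiv_add (hφ x) (mdifferentiableAt_const (c := c) (I := 𝓡∂ 2))
  rw [mfderiv_const] at h
  refine LinearMap.ext fun v => ?_
  have hv := congrArg (fun L : EuclideanSpace ℝ (Fin 2) →L[ℝ] ℝ => L v) h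
  exact hv.trans (add_zero (mfderiv (𝓡∂ 2) 𝓘(ℝ, ℝ) φ x v : ℝ))

variable [IsManifold (𝓡∂ 2) ∞ M]

/-- Read in the trivialization at `p`, this section is constant. -/
theorem contMDiffOn_coordVector (p : M) (i : Fin 2) :
    ContMDiffOn (𝓡∂ 2) ((𝓡∂ 2).prod 𝓘(ℝ, EuclideanSpace ℝ (Fin 2))) 0
      (fun m : M => TotalSpace.mk' (EuclideanSpace ℝ (Fin 2)) m (coordVector p i m))
      (chartAt (EuclideanHalfSpace 2) p).source := by
  have := (trivializationAt (EuclideanSpace ℝ (Fin 2))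
    (TangentSpace (𝓡∂ 2) : M → Type _) p).contMDiffOn_section_baseSet_iff
    (IB := 𝓡∂ 2) (n := 0) (s := coordVector p i)
  rw [TangentBundle.trivializationAt_baseSet] at this
  rw [this]
  refine (contMDiffOn_const (c := EuclideanSpace.single i 1)).congr fun y hy => ?_
  rw [coordVector, Trivialization.symmL_apply _ (by simpa using hy),
    Trivialization.apply_mk_symm _ (by simpa using hy)]

theorem continuousOn_gram_apply (g : Metric M) (p : M) (i j : Fin 2) :
    ContinuousOn (fun m => gram g p m i j) (chartAt (EuclideanHalfSpace 2) p).source := by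
  have h := ContMDiffOn.clm_bundle_apply₂
    (F₁ := EuclideanSpace ℝ (Fin 2)) (F₂ := EuclideanSpace ℝ (Fin 2)) (F₃ := ℝ)
    (E₃ := Bundle.Trivial M ℝ) (b := fun m : M => m)
    ((g.contMDiff.of_le zero_le).contMDiffOn (s := (chartAt (EuclideanHalfSpace 2) p).source))
    (contMDiffOn_coordVector p i) (contMDiffOn_coordVector p j)
  have h' : ContinuousOn (fun m => ((Bundle.TotalSpace.mk' ℝ m (gram g p m i j) :
      TotalSpace ℝ (Bundle.Trivial M ℝ)))) (chartAt (EuclideanHalfSpace 2) p).source :=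
    h.continuousOn
  exact (Bundle.Trivial.homeomorphProd M ℝ).continuous.snd.comp_continuousOn h'

theorem continuousOn_differential_coordVector {φ : M → ℝ}
    (hφ : ContMDiff (𝓡∂ 2) 𝓘(ℝ, ℝ) 1 φ) (p : M) (i : Fin 2) :
    ContinuousOn (fun m => differential φ m (coordVector p i m))
      (chartAt (EuclideanHalfSpace 2) p).source := by
  have h := (hφ.continuous_tangentMap le_rfl).comp_continuousOn
    (contMDiffOn_coordVector p i).continuousOn
  have h2 := (tangentBundleModelSpaceHomeomorph 𝓘(ℝ, ℝ)).continuous.comp_continuousOn h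
  exact continuous_snd.comp_continuousOn h2

/-- Every tangent vector over a chart domain is a combination of the coordinate vectors. -/
theorem exists_eq_combination_coordVector {p m : M}
    (hm : m ∈ (chartAt (EuclideanHalfSpace 2) p).source) (v : TangentSpace (𝓡∂ 2) m) :
    ∃ a b : ℝ, v = a • coordVector p 0 m + b • coordVector p 1 m := by
  set e := trivializationAt (EuclideanSpace ℝ (Fin 2)) (TangentSpace (𝓡∂ 2) : M → Type _) p
  have hm' : m ∈ e.baseSet := by simpa [e] using hm
  refine ⟨e.continuousLinearMapAt ℝ m v 0, e.continuousLinearMapAt ℝ m v 1, ?_⟩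
  rw [coordVector, coordVector, ← map_smul, ← map_smul, ← map_add]
  conv_lhs => rw [← e.symmL_continuousLinearMapAt (R := ℝ) hm' v]
  congr 1
  ext i
  fin_cases i <;> simp

theorem combination_coordVector_ne_zero {p m : M}
    (hm : m ∈ (chartAt (EuclideanHalfSpace 2) p).source) {a b : ℝ} (hab : a ≠ 0 ∨ b ≠ 0) :
    a • coordVector p 0 m + b • coordVector p 1 m ≠ 0 := by
  set e := trivializationAt (EuclideanSpace ℝ (Fin 2)) (TangentSpace (𝓡∂ 2) : M → Type _) p
  have hm' : m ∈ e.baseSet := by simpa [e] using hm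
  intro h
  rw [coordVector, coordVector, ← map_smul, ← map_smul, ← map_add] at h
  have h2 := congrArg (e.continuousLinearMapAt ℝ m) h
  rw [e.continuousLinearMapAt_symmL (R := ℝ) hm', map_zero] at h2
  have h0 := congrArg (fun w : EuclideanSpace ℝ (Fin 2) => w 0) h2
  have h1 := congrArg (fun w : EuclideanSpace ℝ (Fin 2) => w 1) h2
  simp at h0 h1
  tauto

theorem gram_diag_pos (g : Metric M) {p m : M}
    (hm : m ∈ (chartAt (EuclideanHalfSpace 2) p).source) : 0 < gram g p m 1 1 := by
  refine g.pos m _ ?_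
  simpa using combination_coordVector_ne_zero hm (a := 0) (b := 1) (by simp)

theorem gram_symm (g : Metric M) (p m : M) (i j : Fin 2) : gram g p m i j = gram g p m j i :=
  g.symm m _ _

/-- Positive definiteness is tested on `g₁₁ ∂₀ - g₀₁ ∂₁`, whose squared length is `g₁₁ det g`. -/
theorem det_gram_pos (g : Metric M) {p m : M}
    (hm : m ∈ (chartAt (EuclideanHalfSpace 2) p).source) : 0 < (gram g p m).det := by
  have h11 := gram_diag_pos g hm
  have h := g.pos m _ (combination_coordVector_ne_zero hm (a := gram g p m 1 1)
    (b := -gram g p m 0 1) (Or.inl h11.ne'))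
  have h' : 0 < gram g p m 1 1 * (gram g p m).det := by
    convert h using 1
    rw [Matrix.det_fin_two]
    simp only [map_add, map_smul, add_apply, FunLike.coe_smul, Pi.smul_apply,
      smul_eq_mul]
    change _ = gram g p m 1 1 * (gram g p m 1 1 * gram g p m 0 0 +
      -gram g p m 0 1 * gram g p m 1 0) + -gram g p m 0 1 * (gram g p m 1 1 * gram g p m 0 1 +
      -gram g p m 0 1 * gram g p m 1 1)
    ring
  exact pos_of_mul_pos_right h' h11.le

/-- This is `|∇φ|² = gⁱʲ ∂ᵢφ ∂ⱼφ` with the inverse matrix written by cofactors and the determinant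
cleared. It yields continuity of `|∇φ|²`, which the abstract definition of the gradient does not
show. -/
theorem gradientNormSq_mul_det (g : Metric M) (φ : M → ℝ) {p m : M}
    (hm : m ∈ (chartAt (EuclideanHalfSpace 2) p).source) :
    gradientNormSq g φ m * (gram g p m).det =
      gram g p m 1 1 * differential φ m (coordVector p 0 m) ^ 2
      - 2 * gram g p m 0 1 * differential φ m (coordVector p 0 m)
        * differential φ m (coordVector p 1 m)
      + gram g p m 0 0 * differential φ m (coordVector p 1 m) ^ 2 := by
  obtain ⟨a, b, hab⟩ := exists_eq_combination_coordVector hm (gradient g φ m)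
  have key (v : TangentSpace (𝓡∂ 2) m) : differential φ m v =
      a * g.inner m (coordVector p 0 m) v + b * g.inner m (coordVector p 1 m) v := by
    have := inner_gradient g φ m v
    rw [hab] at this
    refine this.symm.trans ?_
    simp
  have hn : gradientNormSq g φ m = a * differential φ m (coordVector p 0 m) +
      b * differential φ m (coordVector p 1 m) := by
    have : gradientNormSq g φ m = differential φ m (gradient g φ m) := inner_gradient g φ m _
    rw [this, hab]; simp
  have h0 : differential φ m (coordVector p 0 m) = a * gram g p m 0 0 + b * gram g p m 0 1 := by
    rw [gram_symm g p m 0 1]; exact key _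
  have h1 : differential φ m (coordVector p 1 m) = a * gram g p m 0 1 + b * gram g p m 1 1 := key _
  rw [hn, h0, h1, Matrix.det_fin_two, gram_symm g p m 1 0]
  ring

theorem continuous_gradientNormSq (g : Metric M) {φ : M → ℝ}
    (hφ : ContMDiff (𝓡∂ 2) 𝓘(ℝ, ℝ) 1 φ) : Continuous (gradientNormSq g φ) := by
  rw [continuous_iff_continuousAt]
  intro p
  have hs := (chartAt (EuclideanHalfSpace 2) p).open_source
  have hp := mem_chart_source (EuclideanHalfSpace 2) p
  have hG (i j) := (continuousOn_gram_apply g p i j).continuousAt (hs.mem_nhds hp)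
  have hd (i) := (continuousOn_differential_coordVector hφ p i).continuousAt (hs.mem_nhds hp)
  have hdet : ContinuousAt (fun m => (gram g p m).det) p := by
    simp_rw [Matrix.det_fin_two]
    exact ((hG 0 0).mul (hG 1 1)).sub ((hG 0 1).mul (hG 1 0))
  have hnum := ((((hG 1 1).mul ((hd 0).pow 2)).sub
    (((continuousAt_const (y := (2 : ℝ))).mul (hG 0 1)).mul (hd 0) |>.mul (hd 1))).add
    ((hG 0 0).mul ((hd 1).pow 2))).div hdet (det_gram_pos g hp).ne'
  refine hnum.congr ?_
  filter_upwards [hs.mem_nhds hp] with m hm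
  exact (eq_div_of_mul_eq (det_gram_pos g hm).ne' (gradientNormSq_mul_det g φ hm)).symm

theorem gradientNormSq_nonneg (g : Metric M) (φ : M → ℝ) (x : M) :
    0 ≤ gradientNormSq g φ x := by
  by_cases h : gradient g φ x = 0
  · simp [gradientNormSq, h]
  · exact (g.pos x _ h).le

theorem gradient_add_const (g : Metric M) {φ : M → ℝ}
    (hφ : MDifferentiable (𝓡∂ 2) 𝓘(ℝ, ℝ) φ) (c : ℝ) (x : M) :
    gradient g (fun y => φ y + c) x = gradient g φ x := by
  rw [gradient, gradient, differential_add_const hφ]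

theorem gradientNormSq_add_const (g : Metric M) {φ : M → ℝ}
    (hφ : MDifferentiable (𝓡∂ 2) 𝓘(ℝ, ℝ) φ) (c : ℝ) (x : M) :
    gradientNormSq g (fun y => φ y + c) x = gradientNormSq g φ x := by
  rw [gradientNormSq, gradientNormSq, gradient_add_const g hφ]

theorem continuousOn_sqrt_det_gram (g : Metric M) (p : M) :
    ContinuousOn (fun m => √(gram g p m).det) (chartAt (EuclideanHalfSpace 2) p).source := by
  simp_rw [Matrix.det_fin_two]
  have hG := continuousOn_gram_apply g p
  exact (((hG 0 0).mul (hG 1 1)).sub ((hG 0 1).mul (hG 1 0))).sqrt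

theorem continuousOn_sqrt_gram_diag (g : Metric M) (p : M) :
    ContinuousOn (fun m => √(gram g p m 1 1)) (chartAt (EuclideanHalfSpace 2) p).source :=
  (continuousOn_gram_apply g p 1 1).sqrt

/-! ### Pointwise conformal scaling. -/

variable {g₀ g : Metric M} {f : M → ℝ}

theorem gradient_conformal
    (hg : ∀ (x : M) (v w : TangentSpace (𝓡∂ 2) x),
      g.inner x v w = Real.exp (2 * f x) * g₀.inner x v w) (φ : M → ℝ) (x : M) :
    gradient g₀ φ x = Real.exp (2 * f x) • gradient g φ x := by
  refine flat_injective g₀ x (LinearMap.ext fun v => ?_)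
  change g₀.inner x _ v = g₀.inner x _ v
  rw [inner_gradient, map_smul]
  have := hg x (gradient g φ x) v
  rw [inner_gradient] at this
  simpa using this

theorem gradientNormSq_conformal
    (hg : ∀ (x : M) (v w : TangentSpace (𝓡∂ 2) x),
      g.inner x v w = Real.exp (2 * f x) * g₀.inner x v w) (φ : M → ℝ) (x : M) :
    gradientNormSq g₀ φ x = Real.exp (2 * f x) * gradientNormSq g φ x := by
  simp only [gradientNormSq, gradient_conformal hg, hg]
  simp

theorem gram_conformal
    (hg : ∀ (x : M) (v w : TangentSpace (𝓡∂ 2) x),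
      g.inner x v w = Real.exp (2 * f x) * g₀.inner x v w) (p m : M) :
    gram g p m = Real.exp (2 * f m) • gram g₀ p m := by
  ext i j
  exact hg m _ _

/-- Dimension two enters here: a 2×2 determinant scales by the square of `e^{2f}`, so the area
density gains exactly `e^{2f}`. -/
theorem sqrt_det_gram_conformal
    (hg : ∀ (x : M) (v w : TangentSpace (𝓡∂ 2) x),
      g.inner x v w = Real.exp (2 * f x) * g₀.inner x v w) (p m : M) :
    √(gram g p m).det = √(gram g₀ p m).det * Real.exp (2 * f m) := by
  rw [gram_conformal hg, Matrix.det_smul, Fintype.card_fin, Real.sqrt_mul (by positivity),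
    Real.sqrt_sq (Real.exp_pos _).le, mul_comm]

theorem sqrt_gram_diag_conformal
    (hg : ∀ (x : M) (v w : TangentSpace (𝓡∂ 2) x),
      g.inner x v w = Real.exp (2 * f x) * g₀.inner x v w) (p m : M) :
    √(gram g p m 1 1) = √(gram g₀ p m 1 1) * Real.exp (f m) := by
  rw [gram_conformal hg, Matrix.smul_apply, smul_eq_mul, Real.sqrt_mul (by positivity), two_mul,
    Real.exp_add, Real.sqrt_mul_self (Real.exp_pos _).le, mul_comm]

end Pointwise

end SteklovSurface

noncomputable section

namespace SteklovSurface

/-! ### Measures glued by a partition of unity. -/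

section Glue

variable {M : Type*} [TopologicalSpace M] [ChartedSpace (EuclideanHalfSpace 2) M]
  [IsManifold (𝓡∂ 2) ∞ M] [T2Space M] [CompactSpace M]

theorem finite_chartPartition_ne_zero :
    {p : M | (Function.support (chartPartition M p)).Nonempty}.Finite :=
  (chartPartition M).locallyFinite.finite_nonempty_of_compact

/-- Values of `w p` outside the chart domain are harmless, because the closed support of the
partition function lies inside it. -/
theorem continuous_chartPartition_mul {w : M → M → ℝ} {p : M}
    (hw : ContinuousOn (w p) (chartAt (EuclideanHalfSpace 2) p).source) :
    Continuous fun m => chartPartition M p m * w p m := by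
  refine continuous_of_tsupport fun x hx => ?_
  have hx' : x ∈ (chartAt (EuclideanHalfSpace 2) p).source :=
    chartPartition_isSubordinate p (tsupport_mul_subset_left hx)
  exact (chartPartition M p).contMDiff.continuous.continuousAt.mul
    (hw.continuousAt ((chartAt (EuclideanHalfSpace 2) p).open_source.mem_nhds hx'))

variable [MeasurableSpace M]

/-- The measure glued from the measures `w p • μ p` on the chart domains by the partition of
unity. -/
def glue (μ : M → Measure M) (w : M → M → ℝ) : Measure M :=
  Measure.sum fun p : M =>
    (μ p).withDensity fun m => ENNReal.ofReal (chartPartition M p m * w p m)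

theorem glue_apply_eq_zero {μ : M → Measure M} {w : M → M → ℝ} {s : Set M}
    (hs : MeasurableSet s) (h : ∀ p, μ p s = 0) : glue μ w s = 0 := by
  rw [glue, Measure.sum_apply _ hs]
  simp only [ENNReal.tsum_eq_zero]
  exact fun p => withDensity_absolutelyContinuous _ _ (h p)

variable [BorelSpace M]

/-- By compactness only finitely many partition functions are nonzero, and each density is bounded
with compact support in its chart. Finiteness of `μ p` is asked only on compact sets, since a whole
chart image may have infinite measure. -/
theorem isFiniteMeasure_glue {μ : M → Measure M} {w : M → M → ℝ}
    (hw : ∀ p, ContinuousOn (w p) (chartAt (EuclideanHalfSpace 2) p).source)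
    (hμ : ∀ p, ∀ K : Set M, IsCompact K → K ⊆ (chartAt (EuclideanHalfSpace 2) p).source →
      μ p K < ⊤) : IsFiniteMeasure (glue μ w) := by
  refine ⟨?_⟩
  rw [glue, Measure.sum_apply _ MeasurableSet.univ,
    tsum_eq_sum (s := finite_chartPartition_ne_zero.toFinset)]
  · refine ENNReal.sum_lt_top.2 fun p _ => ?_
    have hK : IsCompact (tsupport (chartPartition M p)) := (isClosed_tsupport _).isCompact
    obtain ⟨C, hC⟩ := (isCompact_univ (X := M)).exists_bound_of_continuousOn
      (continuous_chartPartition_mul (hw p)).continuousOn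
    rw [withDensity_apply _ MeasurableSet.univ, Measure.restrict_univ]
    calc ∫⁻ m, ENNReal.ofReal (chartPartition M p m * w p m) ∂μ p
        ≤ ∫⁻ m, (tsupport (chartPartition M p)).indicator (fun _ => ENNReal.ofReal C) m ∂μ p := by
          refine lintegral_mono fun m => ?_
          by_cases hm : m ∈ tsupport (chartPartition M p)
          · rw [indicator_of_mem hm]
            exact ENNReal.ofReal_le_ofReal ((le_abs_self _).trans (hC m (mem_univ m)))
          · simp [image_eq_zero_of_notMem_tsupport hm]
      _ = ENNReal.ofReal C * μ p (tsupport (chartPartition M p)) :=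
          lintegral_indicator_const (isClosed_tsupport _).measurableSet _
      _ < ⊤ := ENNReal.mul_lt_top ENNReal.ofReal_lt_top
          (hμ p _ hK (chartPartition_isSubordinate p))
  · intro p hp
    have h0 : ∀ m, chartPartition M p m = 0 := by
      intro m
      by_contra hm
      exact hp (finite_chartPartition_ne_zero.mem_toFinset.2 ⟨m, hm⟩)
    simp [h0]

/-- The factor `e^h` does not depend on the chart, so it comes out of the sum as a global density.
-/
theorem glue_mul_exp {μ : M → Measure M} {w w' : M → M → ℝ} {h : M → ℝ} (hh : Continuous h)
    (hw : ∀ p, ContinuousOn (w p) (chartAt (EuclideanHalfSpace 2) p).source)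
    (hw' : ∀ p m, w' p m = w p m * Real.exp (h m)) :
    glue μ w' = (glue μ w).withDensity fun m => ENNReal.ofReal (Real.exp (h m)) := by
  rw [glue, glue, withDensity_sum]
  congr 1
  ext1 p
  rw [← withDensity_mul]
  · congr 1
    ext1 m
    rw [Pi.mul_apply, ← ENNReal.ofReal_mul' (Real.exp_pos _).le, hw', mul_assoc]
  · exact (continuous_chartPartition_mul (hw p)).measurable.ennreal_ofReal
  · exact (Real.continuous_exp.comp hh).measurable.ennreal_ofReal

/-- Some partition function is positive at `x`. If `U` were null, the open set where that function
is positive inside `U` would be null for `μ p`, against `hμ`. -/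
theorem glue_apply_pos {μ : M → Measure M} {w : M → M → ℝ}
    (hw : ∀ p, ContinuousOn (w p) (chartAt (EuclideanHalfSpace 2) p).source)
    (hpos : ∀ p, ∀ m ∈ (chartAt (EuclideanHalfSpace 2) p).source, 0 < w p m) {x : M}
    (hμ : ∀ p, ∀ V : Set M, IsOpen V → V ⊆ (chartAt (EuclideanHalfSpace 2) p).source → x ∈ V →
      μ p V ≠ 0) {U : Set M} (hU : IsOpen U) (hx : x ∈ U) : 0 < glue μ w U := by
  refine pos_iff_ne_zero.2 fun h0 => ?_
  rw [glue, Measure.sum_apply _ hU.measurableSet, ENNReal.tsum_eq_zero] at h0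
  obtain ⟨p, hp⟩ := (chartPartition M).exists_pos_of_mem (mem_univ x)
  have h1 := (withDensity_apply_eq_zero
    (continuous_chartPartition_mul (hw p)).measurable.ennreal_ofReal).1 (h0 p)
  have hsub : ∀ m, 0 < chartPartition M p m →
      m ∈ (chartAt (EuclideanHalfSpace 2) p).source := fun m hm =>
    chartPartition_isSubordinate p (subset_tsupport _ hm.ne')
  refine hμ p ({m | 0 < chartPartition M p m} ∩ U)
    ((isOpen_lt continuous_const (chartPartition M p).contMDiff.continuous).inter hU)
    (fun m hm => hsub m hm.1) ⟨hp, hx⟩ (measure_mono_null ?_ h1)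
  refine inter_subset_inter_left _ fun m (hm : 0 < chartPartition M p m) => ?_
  simpa using mul_pos hm (hpos p m (hsub m hm))

end Glue

/-! ### Coordinate area and boundary length in a chart. -/

section Charts

variable {M : Type*} [TopologicalSpace M] [ChartedSpace (EuclideanHalfSpace 2) M]

theorem measurableSet_extChartAt_target (p : M) :
    MeasurableSet (extChartAt (𝓡∂ 2) p).target := by
  rw [extChartAt_target]
  exact (((chartAt (EuclideanHalfSpace 2) p).open_target.preimage
    (𝓡∂ 2).continuous_symm).measurableSet).inter (𝓡∂ 2).isClosed_range.measurableSet

theorem continuous_boundaryLine : Continuous fun t : ℝ => !₂[(0 : ℝ), t] := by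
  refine (PiLp.continuous_toLp 2 _).comp (continuous_pi fun i => ?_)
  fin_cases i
  · exact continuous_const
  · exact continuous_id

theorem measurableSet_boundaryLine_preimage (p : M) :
    MeasurableSet {t : ℝ | !₂[(0 : ℝ), t] ∈ (extChartAt (𝓡∂ 2) p).target} :=
  continuous_boundaryLine.measurable (measurableSet_extChartAt_target p)

/-- The boundary is defined through the preferred chart at `x`; interior points can be recognized in
any chart of the atlas, so the one around `p` serves as well. -/
theorem mem_boundary_iff_extChartAt [IsManifold (𝓡∂ 2) ∞ M] {p x : M}
    (hx : x ∈ (chartAt (EuclideanHalfSpace 2) p).source) :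
    x ∈ (𝓡∂ 2).boundary M ↔ extChartAt (𝓡∂ 2) p x 0 = 0 := by
  have hxs : x ∈ (extChartAt (𝓡∂ 2) p).source := by rwa [extChartAt_source]
  have hr := extChartAt_target_subset_range p ((extChartAt (𝓡∂ 2) p).map_source hxs)
  rw [range_modelWithCornersEuclideanHalfSpace] at hr
  have key : (𝓡∂ 2).IsInteriorPoint x ↔ 0 < extChartAt (𝓡∂ 2) p x 0 := by
    rw [(𝓡∂ 2).isInteriorPoint_iff_of_mem_atlas (n := ∞) (by simp) (chart_mem_atlas _ p) hx]
    have h1 : extChartAt (𝓡∂ 2) p x ∈ interior (range (𝓡∂ 2)) ↔ 0 < extChartAt (𝓡∂ 2) p x 0 := by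
      rw [interior_range_modelWithCornersEuclideanHalfSpace]; rfl
    rw [← h1]
    exact ⟨fun h => OpenPartialHomeomorph.interior_extend_target_subset_interior_range _ h,
      fun h => (chartAt (EuclideanHalfSpace 2) p).mem_interior_extend_target
        ((chartAt (EuclideanHalfSpace 2) p).map_source hx) h⟩
  rw [← (𝓡∂ 2).compl_interior]
  change ¬ (𝓡∂ 2).IsInteriorPoint x ↔ _
  rw [key, not_lt]
  exact ⟨fun h => le_antisymm h hr, fun h => h.le⟩

theorem exists_isOpen_extChartAt_symm_preimage (p : M) {V : Set M} (hV : IsOpen V) :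
    ∃ W : Set (EuclideanSpace ℝ (Fin 2)), IsOpen W ∧
      (extChartAt (𝓡∂ 2) p).symm ⁻¹' V ∩ (extChartAt (𝓡∂ 2) p).target = W ∩ range (𝓡∂ 2) := by
  refine ⟨(𝓡∂ 2).symm ⁻¹' ((chartAt (EuclideanHalfSpace 2) p).symm ⁻¹' V ∩
    (chartAt (EuclideanHalfSpace 2) p).target), ?_, ?_⟩
  · rw [inter_comm]
    exact ((chartAt (EuclideanHalfSpace 2) p).symm.isOpen_inter_preimage hV).preimage
      (𝓡∂ 2).continuous_symm
  · rw [extChartAt_target]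
    ext y
    simp [and_assoc]

variable [MeasurableSpace M]

/-- The area measure of the coordinate plane, carried to the domain of the chart around `p`. -/
def chartArea (p : M) : Measure M :=
  ((volume : Measure (EuclideanSpace ℝ (Fin 2))).restrict (extChartAt (𝓡∂ 2) p).target).map
    (extChartAt (𝓡∂ 2) p).symm

/-- The length measure of the boundary of the coordinate half plane, carried to the domain of the
chart around `p`. -/
def chartLength (p : M) : Measure M :=
  ((volume : Measure ℝ).restrict {t : ℝ | !₂[(0 : ℝ), t] ∈ (extChartAt (𝓡∂ 2) p).target}).map
    fun t => (extChartAt (𝓡∂ 2) p).symm !₂[(0 : ℝ), t]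

variable [BorelSpace M]

theorem chartArea_apply (p : M) {s : Set M} (hs : MeasurableSet s) :
    chartArea p s =
      volume ((extChartAt (𝓡∂ 2) p).symm ⁻¹' s ∩ (extChartAt (𝓡∂ 2) p).target) := by
  rw [chartArea, Measure.map_apply_of_aemeasurable _ hs,
    Measure.restrict_apply' (measurableSet_extChartAt_target p)]
  exact (continuousOn_extChartAt_symm p).aemeasurable (measurableSet_extChartAt_target p)

theorem chartLength_apply (p : M) {s : Set M} (hs : MeasurableSet s) :
    chartLength p s =
      volume {t : ℝ | (extChartAt (𝓡∂ 2) p).symm !₂[(0 : ℝ), t] ∈ s ∧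
        !₂[(0 : ℝ), t] ∈ (extChartAt (𝓡∂ 2) p).target} := by
  rw [chartLength, Measure.map_apply_of_aemeasurable _ hs,
    Measure.restrict_apply' (measurableSet_boundaryLine_preimage p)]
  · rfl
  · exact ((continuousOn_extChartAt_symm p).comp continuous_boundaryLine.continuousOn
      (fun _ ht => ht)).aemeasurable (measurableSet_boundaryLine_preimage p)

theorem chartArea_lt_top [T2Space M] (p : M) (K : Set M) (hK : IsCompact K)
    (hKp : K ⊆ (chartAt (EuclideanHalfSpace 2) p).source) : chartArea p K < ⊤ := by
  rw [chartArea_apply p hK.measurableSet]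
  refine lt_of_le_of_lt (measure_mono ?_)
    (hK.image_of_continuousOn ((continuousOn_extChartAt (I := 𝓡∂ 2) p).mono
      (by rwa [extChartAt_source]))).measure_lt_top
  rintro y ⟨hy, hy'⟩
  exact ⟨_, hy, (extChartAt (𝓡∂ 2) p).right_inv hy'⟩

theorem chartLength_lt_top [T2Space M] (p : M) (K : Set M) (hK : IsCompact K)
    (hKp : K ⊆ (chartAt (EuclideanHalfSpace 2) p).source) : chartLength p K < ⊤ := by
  rw [chartLength_apply p hK.measurableSet]
  have hc := (hK.image_of_continuousOn ((continuousOn_extChartAt (I := 𝓡∂ 2) p).mono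
      (by rwa [extChartAt_source]))).image
      -- The parameters `t` in question lie in the projection to the coordinate `x¹` of the compact
      -- image of `K`.
      (show Continuous fun y : EuclideanSpace ℝ (Fin 2) => y 1 by fun_prop)
  refine lt_of_le_of_lt (measure_mono ?_) hc.measure_lt_top
  rintro t ⟨ht, ht'⟩
  exact ⟨_, ⟨_, ht, (extChartAt (𝓡∂ 2) p).right_inv ht'⟩, by simp⟩

theorem chartArea_ne_zero {p x : M} {V : Set M} (hV : IsOpen V)
    (hVp : V ⊆ (chartAt (EuclideanHalfSpace 2) p).source) (hx : x ∈ V) : chartArea p V ≠ 0 := by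
  rw [chartArea_apply p hV.measurableSet]
  obtain ⟨W, hW, hWV⟩ := exists_isOpen_extChartAt_symm_preimage p hV
  have hxs : x ∈ (extChartAt (𝓡∂ 2) p).source := by rw [extChartAt_source]; exact hVp hx
  have hxW : extChartAt (𝓡∂ 2) p x ∈ W ∩ range (𝓡∂ 2) := by
    rw [← hWV]
    exact ⟨by rwa [mem_preimage, (extChartAt (𝓡∂ 2) p).left_inv hxs],
      (extChartAt (𝓡∂ 2) p).map_source hxs⟩
  rw [hWV]
  -- `x` may be a boundary point, but the half plane is the closure of its interior, so `W` meets
  -- that interior in a nonempty open set.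
  obtain ⟨y, hy, hy'⟩ := mem_closure_iff.1 ((𝓡∂ 2).range_subset_closure_interior hxW.2) W hW hxW.1
  refine fun h0 => ((hW.inter isOpen_interior).measure_pos volume ⟨y, hy, hy'⟩).ne' ?_
  exact measure_mono_null (inter_subset_inter_right _ interior_subset) h0

theorem chartLength_ne_zero [IsManifold (𝓡∂ 2) ∞ M] {p x : M} (hxb : x ∈ (𝓡∂ 2).boundary M)
    {V : Set M} (hV : IsOpen V)
    (hVp : V ⊆ (chartAt (EuclideanHalfSpace 2) p).source) (hx : x ∈ V) : chartLength p V ≠ 0 := by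
  rw [chartLength_apply p hV.measurableSet]
  obtain ⟨W, hW, hWV⟩ := exists_isOpen_extChartAt_symm_preimage p hV
  have hxs : x ∈ (extChartAt (𝓡∂ 2) p).source := by rw [extChartAt_source]; exact hVp hx
  have hxW : extChartAt (𝓡∂ 2) p x ∈ W ∩ range (𝓡∂ 2) := by
    rw [← hWV]
    exact ⟨by rwa [mem_preimage, (extChartAt (𝓡∂ 2) p).left_inv hxs],
      (extChartAt (𝓡∂ 2) p).map_source hxs⟩
  have hx0 : !₂[(0 : ℝ), extChartAt (𝓡∂ 2) p x 1] = extChartAt (𝓡∂ 2) p x := by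
    ext i
    fin_cases i
    · simpa using ((mem_boundary_iff_extChartAt (hVp hx)).1 hxb).symm
    · simp
  refine fun h0 => ((hW.preimage continuous_boundaryLine).measure_pos volume
    ⟨extChartAt (𝓡∂ 2) p x 1, by rw [mem_preimage, hx0]; exact hxW.1⟩).ne' ?_
  refine measure_mono_null (fun t ht => ?_) h0
  have : !₂[(0 : ℝ), t] ∈ W ∩ range (𝓡∂ 2) :=
    ⟨ht, by rw [range_modelWithCornersEuclideanHalfSpace]; simp⟩
  rwa [← hWV] at this

theorem chartLength_eq_zero [IsManifold (𝓡∂ 2) ∞ M] (p : M) {s : Set M} (hs : MeasurableSet s)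
    (hsb : ∀ x ∈ s, x ∉ (𝓡∂ 2).boundary M) : chartLength p s = 0 := by
  rw [chartLength_apply p hs]
  refine measure_mono_null (t := ∅) (fun t ⟨ht, ht'⟩ => hsb _ ht ?_) measure_empty
  rw [mem_boundary_iff_extChartAt (p := p), (extChartAt (𝓡∂ 2) p).right_inv ht']
  · simp
  · rw [← extChartAt_source (𝓡∂ 2)]
    exact (extChartAt (𝓡∂ 2) p).map_target ht'

end Charts

end SteklovSurface

end

namespace SteklovSurface

/-! ### Integrals of continuous functions and exponential densities. -/

section Integrals

variable {M : Type*} [TopologicalSpace M] [MeasurableSpace M] [BorelSpace M]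

theorem integrable_of_continuous [CompactSpace M] (μ : Measure M) [IsFiniteMeasure μ] {h : M → ℝ}
    (hh : Continuous h) : Integrable h μ :=
  hh.integrable_of_hasCompactSupport (HasCompactSupport.of_compactSpace h)

theorem integral_withDensity_exp (μ : Measure M) {h : M → ℝ} (hh : Continuous h) (u : M → ℝ) :
    ∫ x, u x ∂(μ.withDensity fun m => ENNReal.ofReal (Real.exp (h m))) =
      ∫ x, Real.exp (h x) * u x ∂μ := by
  rw [integral_withDensity_eq_integral_toReal_smul
    (hh.rexp.measurable.ennreal_ofReal) (by simp)]
  simp [ENNReal.toReal_ofReal (Real.exp_pos _).le]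

end Integrals

/-! ### Nonconstant functions and positivity of the energy and boundary integrals. -/

section Functions

variable {M : Type*} [TopologicalSpace M] [ChartedSpace (EuclideanHalfSpace 2) M]
  [IsManifold (𝓡∂ 2) ∞ M]

theorem gradient_ne_zero_of_differential_apply_ne_zero (g : Metric M) {φ : M → ℝ} {x : M}
    {v : TangentSpace (𝓡∂ 2) x} (h : differential φ x v ≠ 0) : gradient g φ x ≠ 0 := by
  intro h0
  apply h
  have : g.inner x (gradient g φ x) v = differential φ x v := inner_gradient g φ x v
  rw [← this, h0]
  simp

/-- Around any point there is a smooth function that agrees with a chart coordinate. -/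
theorem exists_contMDiff_gradient_ne_zero [T2Space M] (g : Metric M) (x : M) :
    ∃ φ : M → ℝ, ContMDiff (𝓡∂ 2) 𝓘(ℝ, ℝ) 1 φ ∧ gradient g φ x ≠ 0 := by
  let L : EuclideanSpace ℝ (Fin 2) →L[ℝ] ℝ := EuclideanSpace.proj 0
  let β : SmoothBumpFunction (𝓡∂ 2) x := Classical.arbitrary _
  refine ⟨fun y => β y • L (extChartAt (𝓡∂ 2) x y), ?_, ?_⟩
  · refine (β.contMDiff_smul ?_).of_le (by norm_num)
    exact L.contMDiff.comp_contMDiffOn contMDiffOn_extChartAt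
  · have hM := hasMFDerivAt_extChartAt (I := 𝓡∂ 2) (mem_chart_source (EuclideanHalfSpace 2) x)
    have hL := (L.hasMFDerivAt (x := extChartAt (𝓡∂ 2) x x)).comp x hM
    -- The bump function is one near `x`, so the product has the derivative of the coordinate there.
    have hφ := hL.congr_of_eventuallyEq (f₁ := fun y => β y • L (extChartAt (𝓡∂ 2) x y)) (by
      filter_upwards [β.eventuallyEq_one] with y hy
      simp [hy])
    obtain ⟨v, hv⟩ := (isInvertible_mfderiv_extChartAt (I := 𝓡∂ 2)
      (mem_extChartAt_source x)).surjective (EuclideanSpace.single 0 1)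
    refine gradient_ne_zero_of_differential_apply_ne_zero g (v := v) ?_
    have hval : differential (fun y => β y • L (extChartAt (𝓡∂ 2) x y)) x v =
        L (mfderiv (𝓡∂ 2) 𝓘(ℝ, EuclideanSpace ℝ (Fin 2)) (extChartAt (𝓡∂ 2) x) x v) := by
      rw [hM.mfderiv]
      exact congrArg (fun A : EuclideanSpace ℝ (Fin 2) →L[ℝ] ℝ => A v) hφ.mfderiv
    rw [hval, hv]
    simp [L]

variable [T2Space M] [CompactSpace M]

/-- There is a positive function with nonzero gradient at a given point. -/
theorem exists_pos_gradient_ne_zero (g : Metric M) (x : M) :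
    ∃ φ : M → ℝ, ContMDiff (𝓡∂ 2) 𝓘(ℝ, ℝ) 1 φ ∧ (∀ y, 0 < φ y) ∧ gradient g φ x ≠ 0 := by
  obtain ⟨φ, hφ, hx⟩ := exists_contMDiff_gradient_ne_zero g x
  obtain ⟨C, hC⟩ := (isCompact_univ (X := M)).exists_bound_of_continuousOn hφ.continuous.continuousOn
  refine ⟨fun y => φ y + (C + 1), hφ.add contMDiff_const, fun y => ?_, ?_⟩
  · have := neg_le_of_abs_le (hC y (mem_univ y))
    linarith
  · rwa [gradient_add_const g (hφ.mdifferentiable one_ne_zero)]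

variable [MeasurableSpace M]

theorem area_eq_glue (g : Metric M) :
    area g = glue chartArea fun p m => √(gram g p m).det := rfl

theorem boundaryLength_eq_glue (g : Metric M) :
    boundaryLength g = glue chartLength fun p m => √(gram g p m 1 1) := rfl

theorem energy_nonneg (g : Metric M) (φ : M → ℝ) :
    0 ≤ ∫ y, gradientNormSq g φ y ∂(area g) :=
  integral_nonneg (gradientNormSq_nonneg g φ)

theorem rayleigh_nonneg (g : Metric M) (φ : M → ℝ) : 0 ≤ rayleigh g φ :=
  div_nonneg (energy_nonneg g φ) (integral_nonneg fun _ => sq_nonneg _)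

variable [BorelSpace M]

instance (g : Metric M) : IsFiniteMeasure (area g) :=
  isFiniteMeasure_glue (continuousOn_sqrt_det_gram g) chartArea_lt_top

instance (g : Metric M) : IsFiniteMeasure (boundaryLength g) :=
  isFiniteMeasure_glue (continuousOn_sqrt_gram_diag g) chartLength_lt_top

theorem area_pos (g : Metric M) {U : Set M} (hU : IsOpen U) {x : M} (hx : x ∈ U) :
    0 < area g U :=
  glue_apply_pos (continuousOn_sqrt_det_gram g)
    (fun _ _ hm => Real.sqrt_pos.2 (det_gram_pos g hm))
    (fun _ _ hV hVp hxV => chartArea_ne_zero hV hVp hxV) hU hx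

theorem boundaryLength_pos (g : Metric M) {U : Set M} (hU : IsOpen U) {x : M} (hx : x ∈ U)
    (hxb : x ∈ (𝓡∂ 2).boundary M) : 0 < boundaryLength g U :=
  glue_apply_pos (continuousOn_sqrt_gram_diag g)
    (fun _ _ hm => Real.sqrt_pos.2 (gram_diag_pos g hm))
    (fun _ _ hV hVp hxV => chartLength_ne_zero hxb hV hVp hxV) hU hx

theorem ae_mem_boundary (g : Metric M) : ∀ᵐ x ∂(boundaryLength g), x ∈ (𝓡∂ 2).boundary M :=
  glue_apply_eq_zero
    ((𝓡∂ 2).isClosed_boundary (M := M) (n := ∞) (by simp)).measurableSet.compl fun p =>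
      chartLength_eq_zero p
        ((𝓡∂ 2).isClosed_boundary (M := M) (n := ∞) (by simp)).measurableSet.compl fun _ hx => hx

/-- Boundary length is carried by `∂M`, so the sign of `h` matters only there. This is needed for
`(K e^f - 1) φ²`, which may be negative in the interior. -/
theorem boundary_integral_pos (g : Metric M) {h : M → ℝ} (hh : Continuous h)
    (h0 : ∀ x ∈ (𝓡∂ 2).boundary M, 0 ≤ h x) {x : M} (hxb : x ∈ (𝓡∂ 2).boundary M)
    (hx : 0 < h x) : 0 < ∫ y, h y ∂(boundaryLength g) := by
  rw [integral_pos_iff_support_of_nonneg_ae _ (integrable_of_continuous _ hh)]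
  · exact boundaryLength_pos g hh.isOpen_support (Function.mem_support.2 hx.ne') hxb
  · filter_upwards [ae_mem_boundary g] with y hy using h0 y hy

theorem energy_pos (g : Metric M) {φ : M → ℝ} (hφ : ContMDiff (𝓡∂ 2) 𝓘(ℝ, ℝ) 1 φ) {x : M}
    (hx : gradient g φ x ≠ 0) : 0 < ∫ y, gradientNormSq g φ y ∂(area g) := by
  have hc := continuous_gradientNormSq g hφ
  rw [integral_pos_iff_support_of_nonneg (gradientNormSq_nonneg g φ)
    (integrable_of_continuous _ hc)]
  exact area_pos g hc.isOpen_support (Function.mem_support.2 (g.pos x _ hx).ne')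

theorem IsTest.boundary_integral_sq_pos {φ : M → ℝ} (hφ : IsTest φ) (g : Metric M) :
    0 < ∫ y, φ y ^ 2 ∂(boundaryLength g) := by
  obtain ⟨x, hxb, hx⟩ := hφ.ne_zero
  exact boundary_integral_pos g (hφ.contMDiff.continuous.pow 2) (fun _ _ => sq_nonneg _) hxb
    (by positivity)

end Functions

/-! ### Comparison of Rayleigh quotients and first eigenvalues. -/

section Conformal

variable {M : Type*} [TopologicalSpace M] [ChartedSpace (EuclideanHalfSpace 2) M]
  [IsManifold (𝓡∂ 2) ∞ M] [T2Space M] [CompactSpace M] [MeasurableSpace M] [BorelSpace M]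
  {g₀ g : Metric M} {f : M → ℝ}

theorem energy_conformal (hf : Continuous f)
    (hg : ∀ (x : M) (v w : TangentSpace (𝓡∂ 2) x),
      g.inner x v w = Real.exp (2 * f x) * g₀.inner x v w) (φ : M → ℝ) :
    ∫ x, gradientNormSq g φ x ∂(area g) = ∫ x, gradientNormSq g₀ φ x ∂(area g₀) := by
  have h2 : Continuous fun x => 2 * f x := continuous_const.mul hf
  rw [area_eq_glue g, glue_mul_exp h2 (continuousOn_sqrt_det_gram g₀) (sqrt_det_gram_conformal hg),
    ← area_eq_glue, integral_withDensity_exp _ h2]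
  simp_rw [gradientNormSq_conformal hg]

theorem boundary_integral_conformal (hf : Continuous f)
    (hg : ∀ (x : M) (v w : TangentSpace (𝓡∂ 2) x),
      g.inner x v w = Real.exp (2 * f x) * g₀.inner x v w) (u : M → ℝ) :
    ∫ x, u x ∂(boundaryLength g) = ∫ x, Real.exp (f x) * u x ∂(boundaryLength g₀) := by
  rw [boundaryLength_eq_glue g,
    glue_mul_exp hf (continuousOn_sqrt_gram_diag g₀) (sqrt_gram_diag_conformal hg),
    ← boundaryLength_eq_glue, integral_withDensity_exp _ hf]

/-- If `e^{-f} ≤ K` on the boundary, then boundary integrals of nonnegative functions grow at most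
by the factor `K` from `g` to `g₀`. -/
theorem boundary_integral_le (hf : Continuous f)
    (hg : ∀ (x : M) (v w : TangentSpace (𝓡∂ 2) x),
      g.inner x v w = Real.exp (2 * f x) * g₀.inner x v w) {K : ℝ}
    (hK : ∀ x ∈ (𝓡∂ 2).boundary M, Real.exp (-f x) ≤ K) {u : M → ℝ} (hu : Continuous u)
    (hu0 : ∀ x, 0 ≤ u x) :
    ∫ x, u x ∂(boundaryLength g₀) ≤ K * ∫ x, u x ∂(boundaryLength g) := by
  rw [boundary_integral_conformal hf hg, ← integral_const_mul]
  refine integral_mono_ae (integrable_of_continuous _ hu)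
    (integrable_of_continuous _ (by fun_prop)) ?_
  filter_upwards [ae_mem_boundary g₀] with x hx
  have h1 : 1 ≤ K * Real.exp (f x) := by
    have := mul_le_mul_of_nonneg_right (hK x hx) (Real.exp_pos (f x)).le
    rwa [← Real.exp_add, neg_add_cancel, Real.exp_zero] at this
  calc u x = 1 * u x := (one_mul _).symm
    _ ≤ K * Real.exp (f x) * u x := mul_le_mul_of_nonneg_right h1 (hu0 x)
    _ = _ := mul_assoc _ _ _

theorem rayleigh_le (hf : Continuous f)
    (hg : ∀ (x : M) (v w : TangentSpace (𝓡∂ 2) x),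
      g.inner x v w = Real.exp (2 * f x) * g₀.inner x v w) {K : ℝ}
    (hK : ∀ x ∈ (𝓡∂ 2).boundary M, Real.exp (-f x) ≤ K) {φ : M → ℝ} (hφ : IsTest φ) :
    rayleigh g φ ≤ K * rayleigh g₀ φ := by
  have hB := boundary_integral_le hf hg hK (u := fun x => φ x ^ 2)
    (hφ.contMDiff.continuous.pow 2) fun _ => sq_nonneg _
  have hB0 := hφ.boundary_integral_sq_pos g₀
  have hB1 := hφ.boundary_integral_sq_pos g
  rw [rayleigh, rayleigh, energy_conformal hf hg, ← mul_div_assoc, div_le_div_iff₀ hB1 hB0]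
  have := mul_le_mul_of_nonneg_left hB (energy_nonneg g₀ φ)
  linarith

/-- If the Rayleigh quotients satisfy the reverse of `rayleigh_le`, the conformal factor takes its
extreme value wherever `φ` does not vanish on the boundary. -/
theorem exp_neg_eq_of_rayleigh_ge (hf : Continuous f)
    (hg : ∀ (x : M) (v w : TangentSpace (𝓡∂ 2) x),
      g.inner x v w = Real.exp (2 * f x) * g₀.inner x v w) {K : ℝ}
    (hK : ∀ x ∈ (𝓡∂ 2).boundary M, Real.exp (-f x) ≤ K) {φ : M → ℝ} (hφ : IsTest φ)
    (hgrad : ∃ x, gradient g₀ φ x ≠ 0) (hge : rayleigh g φ ≥ K * rayleigh g₀ φ) {x : M}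
    (hxb : x ∈ (𝓡∂ 2).boundary M) (hx : φ x ≠ 0) : Real.exp (-f x) = K := by
  obtain ⟨y, hy⟩ := hgrad
  have hE := energy_pos g₀ hφ.contMDiff hy
  have hB0 := hφ.boundary_integral_sq_pos g₀
  have hB1 := hφ.boundary_integral_sq_pos g
  have hφc := hφ.contMDiff.continuous
  -- Cancelling the common positive energy leaves `∫ K e^f φ² dσ₀ ≤ ∫ φ² dσ₀`.
  rw [rayleigh, rayleigh, energy_conformal hf hg, ge_iff_le, ← mul_div_assoc,
    div_le_div_iff₀ hB0 hB1, mul_comm K, mul_assoc, mul_le_mul_iff_right₀ hE,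
    boundary_integral_conformal hf hg, ← integral_const_mul] at hge
  by_contra hne
  have hlt := lt_of_le_of_ne (hK x hxb) hne
  have hfac (z : M) : K * (Real.exp (f z) * φ z ^ 2) - φ z ^ 2 =
      (K - Real.exp (-f z)) * (Real.exp (f z) * φ z ^ 2) := by
    have : Real.exp (-f z) * Real.exp (f z) = 1 := by rw [← Real.exp_add]; simp
    linear_combination (φ z ^ 2) * this
  have hpos := boundary_integral_pos g₀
    (h := fun z => K * (Real.exp (f z) * φ z ^ 2) - φ z ^ 2) (by fun_prop)
    (fun z hz => by
      rw [hfac]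
      exact mul_nonneg (sub_nonneg.2 (hK z hz)) (by positivity)) hxb
    (by
      rw [hfac]
      exact mul_pos (sub_pos.2 hlt) (by positivity))
  rw [integral_sub (integrable_of_continuous _ (by fun_prop))
    (integrable_of_continuous _ (by fun_prop))] at hpos
  linarith

theorem rayleigh_eq_of_const (hf : Continuous f)
    (hg : ∀ (x : M) (v w : TangentSpace (𝓡∂ 2) x),
      g.inner x v w = Real.exp (2 * f x) * g₀.inner x v w) {c : ℝ}
    (hc : ∀ x ∈ (𝓡∂ 2).boundary M, f x = c) (φ : M → ℝ) :
    rayleigh g φ = Real.exp (-c) * rayleigh g₀ φ := by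
  have hB : ∫ x, φ x ^ 2 ∂(boundaryLength g) =
      Real.exp c * ∫ x, φ x ^ 2 ∂(boundaryLength g₀) := by
    rw [boundary_integral_conformal hf hg, ← integral_const_mul]
    refine integral_congr_ae ?_
    filter_upwards [ae_mem_boundary g₀] with x hx
    simp only [hc x hx]
  rw [rayleigh, rayleigh, energy_conformal hf hg, hB, Real.exp_neg, div_mul_eq_div_div_swap,
    div_eq_inv_mul _ (Real.exp c)]

/-- Recentering a test function for `g₀` gives a test function for `g`, whose Rayleigh quotient is
controlled. -/
theorem exists_centered_rayleigh_le (hf : Continuous f)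
    (hg : ∀ (x : M) (v w : TangentSpace (𝓡∂ 2) x),
      g.inner x v w = Real.exp (2 * f x) * g₀.inner x v w) {K : ℝ}
    (hK : ∀ x ∈ (𝓡∂ 2).boundary M, Real.exp (-f x) ≤ K) {φ : M → ℝ} (hφ : IsTest φ)
    (hmean : ∫ x, φ x ∂(boundaryLength g₀) = 0) :
    ∃ ψ : M → ℝ, IsTest ψ ∧ ∫ x, ψ x ∂(boundaryLength g) = 0 ∧
      rayleigh g ψ ≤ K * rayleigh g₀ φ := by
  have hφc := hφ.contMDiff.continuous
  obtain ⟨x, hxb, hx⟩ := hφ.ne_zero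
  have hlen : 0 < ∫ _, (1 : ℝ) ∂(boundaryLength g) :=
    boundary_integral_pos g continuous_const (fun _ _ => zero_le_one) hxb one_pos
  -- The constant that makes the `g`-mean of `φ + c` zero.
  set c : ℝ := -(∫ y, φ y ∂(boundaryLength g)) / ∫ _, (1 : ℝ) ∂(boundaryLength g) with hc
  have hψc : ContMDiff (𝓡∂ 2) 𝓘(ℝ, ℝ) 1 fun y => φ y + c := hφ.contMDiff.add contMDiff_const
  -- The cross term `2c ∫ φ dσ₀` vanishes because `φ` has `g₀`-mean zero.
  have hsq : ∫ y, φ y ^ 2 ∂(boundaryLength g₀) ≤ ∫ y, (φ y + c) ^ 2 ∂(boundaryLength g₀) := by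
    have hexp : ∫ y, (φ y + c) ^ 2 ∂(boundaryLength g₀) =
        ∫ y, φ y ^ 2 ∂(boundaryLength g₀) + ∫ y, 2 * c * φ y ∂(boundaryLength g₀) +
          ∫ _, c ^ 2 ∂(boundaryLength g₀) := by
      rw [← integral_add (integrable_of_continuous _ (by fun_prop))
        (integrable_of_continuous _ (by fun_prop)),
        ← integral_add (integrable_of_continuous _ (by fun_prop))
        (integrable_of_continuous _ (by fun_prop))]
      congr 1
      ext y
      ring
    rw [hexp, integral_const_mul, hmean]
    have : 0 ≤ ∫ _, c ^ 2 ∂(boundaryLength g₀) := integral_nonneg fun _ => sq_nonneg c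
    linarith
  have hB0 := hφ.boundary_integral_sq_pos g₀
  have hψ : IsTest fun y => φ y + c := by
    refine ⟨hψc, ?_⟩
    by_contra! h
    have : ∫ y, (φ y + c) ^ 2 ∂(boundaryLength g₀) = 0 := by
      refine integral_eq_zero_of_ae ?_
      filter_upwards [ae_mem_boundary g₀] with y hy
      simp [h y hy]
    linarith
  have hKpos : 0 ≤ K := (Real.exp_pos _).le.trans (hK x hxb)
  refine ⟨_, hψ, ?_, (rayleigh_le hf hg hK hψ).trans (mul_le_mul_of_nonneg_left ?_ hKpos)⟩
  · rw [integral_add (integrable_of_continuous _ hφc) (integrable_of_continuous _ continuous_const)]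
    have : ∫ _, c ∂(boundaryLength g) = c * ∫ _, (1 : ℝ) ∂(boundaryLength g) := by
      rw [← integral_const_mul]
      simp
    rw [this, hc, div_mul_cancel₀ _ hlen.ne', add_neg_cancel]
  · rw [rayleigh, rayleigh]
    simp_rw [gradientNormSq_add_const g₀ (hφ.contMDiff.mdifferentiable one_ne_zero)]
    exact div_le_div_of_nonneg_left (energy_nonneg g₀ φ) hB0 hsq

theorem firstSteklov_le (hf : Continuous f)
    (hg : ∀ (x : M) (v w : TangentSpace (𝓡∂ 2) x),
      g.inner x v w = Real.exp (2 * f x) * g₀.inner x v w) {K : ℝ} (hK0 : 0 < K)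
    (hK : ∀ x ∈ (𝓡∂ 2).boundary M, Real.exp (-f x) ≤ K) :
    firstSteklov g ≤ K * firstSteklov g₀ := by
  have hbdd : BddBelow {q | ∃ φ : M → ℝ, IsTest φ ∧ ∫ x, φ x ∂(boundaryLength g) = 0 ∧
      q = rayleigh g φ} := by
    refine ⟨0, ?_⟩
    rintro _ ⟨φ, -, -, rfl⟩
    exact rayleigh_nonneg g φ
  by_cases hne : {q | ∃ φ : M → ℝ, IsTest φ ∧ ∫ x, φ x ∂(boundaryLength g₀) = 0 ∧
      q = rayleigh g₀ φ}.Nonempty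
  · rw [← div_le_iff₀' hK0]
    refine le_csInf hne ?_
    rintro _ ⟨φ, hφ, hmean, rfl⟩
    rw [div_le_iff₀' hK0]
    obtain ⟨ψ, hψ, hψm, hle⟩ := exists_centered_rayleigh_le hf hg hK hφ hmean
    exact (csInf_le hbdd ⟨ψ, hψ, hψm, rfl⟩).trans hle
  -- An infimum over the empty set is `0` by convention, so it must be shown that the competitors
  -- for `g` are then absent too. Recentering with the metrics exchanged and `f` replaced by `-f`
  -- does this; any upper bound `C` for `e^f` suffices.
  · have hne' : {q | ∃ φ : M → ℝ, IsTest φ ∧ ∫ x, φ x ∂(boundaryLength g) = 0 ∧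
        q = rayleigh g φ} = ∅ := by
      refine eq_empty_of_forall_notMem ?_
      rintro _ ⟨φ, hφ, hmean, -⟩
      have hg' (x : M) (v w : TangentSpace (𝓡∂ 2) x) :
          g₀.inner x v w = Real.exp (2 * (-f x)) * g.inner x v w := by
        rw [hg, ← mul_assoc, ← Real.exp_add]
        simp
      obtain ⟨C, hC⟩ := (isCompact_univ (X := M)).exists_bound_of_continuousOn
        (Real.continuous_exp.comp hf).continuousOn
      obtain ⟨ψ, hψ, hψm, -⟩ := exists_centered_rayleigh_le (f := fun x => -f x) hf.neg hg'
        (K := C) (fun x _ => by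
          rw [neg_neg]
          exact (le_abs_self _).trans (hC x (mem_univ x))) hφ hmean
      exact hne ⟨_, ψ, hψ, hψm, rfl⟩
    rw [not_nonempty_iff_eq_empty] at hne
    rw [firstSteklov, firstSteklov, hne, hne']
    simp

end Conformal

end SteklovSurface

/-! ### The main theorem. -/

open SteklovSurface in
theorem mainTheorem1 {M : Type*} [TopologicalSpace M] [ChartedSpace (EuclideanHalfSpace 2) M]
    [IsManifold (𝓡∂ 2) ∞ M] [T2Space M] [CompactSpace M] [MeasurableSpace M] [BorelSpace M]
    (hM : ((𝓡∂ 2).boundary M).Nonempty)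
    (g₀ g : SteklovSurface.Metric M) (f : M → ℝ) (hf : ContMDiff (𝓡∂ 2) 𝓘(ℝ, ℝ) ∞ f)
    (hg : ∀ (x : M) (v w : TangentSpace (𝓡∂ 2) x),
      g.inner x v w = Real.exp (2 * f x) * g₀.inner x v w)
    (K : ℝ) (hK : K = sSup ((fun x => Real.exp (-f x)) '' (𝓡∂ 2).boundary M)) :
    -- the inequality can hold only as an equality
    (∀ φ : M → ℝ, IsTest φ → rayleigh g φ ≥ K * rayleigh g₀ φ →
      rayleigh g φ = K * rayleigh g₀ φ) ∧
    -- if it holds for one `φ` with nonzero gradient, then `f` is constant on `{φ ≠ 0} ∩ ∂M`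
    (∀ φ : M → ℝ, IsTest φ → (∃ x, gradient g₀ φ x ≠ 0) → rayleigh g φ ≥ K * rayleigh g₀ φ →
      ∀ x ∈ (𝓡∂ 2).boundary M, φ x ≠ 0 → Real.exp (-f x) = K) ∧
    -- if it holds for all `φ` with nonzero gradient, then `f` is constant on `∂M`
    ((∀ φ : M → ℝ, IsTest φ → (∃ x, gradient g₀ φ x ≠ 0) → rayleigh g φ ≥ K * rayleigh g₀ φ) →
      ∃ c, ∀ x ∈ (𝓡∂ 2).boundary M, f x = c) ∧
    -- equality occurs if `f` is constant on `∂M`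
    ((∃ c, ∀ x ∈ (𝓡∂ 2).boundary M, f x = c) →
      ∀ φ : M → ℝ, IsTest φ → rayleigh g φ = K * rayleigh g₀ φ) ∧
    -- if `f` is not constant on `∂M`, equality fails for some `φ`
    ((¬ ∃ c, ∀ x ∈ (𝓡∂ 2).boundary M, f x = c) →
      ∃ φ : M → ℝ, IsTest φ ∧ (∃ x, gradient g₀ φ x ≠ 0) ∧
        rayleigh g φ ≠ K * rayleigh g₀ φ) ∧
    -- the bound for the first nonzero eigenvalue is never strict
    (ConnectedSpace M → firstSteklov g ≥ K * firstSteklov g₀ →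
      firstSteklov g = K * firstSteklov g₀) := by
  have hfc : Continuous f := hf.continuous
  have hKle : ∀ x ∈ (𝓡∂ 2).boundary M, Real.exp (-f x) ≤ K := by
    intro x hx
    obtain ⟨C, hC⟩ := (isCompact_univ (X := M)).exists_bound_of_continuousOn
      (Real.continuous_exp.comp hfc.neg).continuousOn
    rw [hK]
    refine le_csSup ⟨C, ?_⟩ (mem_image_of_mem _ hx)
    rintro _ ⟨y, -, rfl⟩
    exact (le_abs_self _).trans (hC y (mem_univ y))
  have hconst : (∀ φ : M → ℝ, IsTest φ → (∃ x, gradient g₀ φ x ≠ 0) →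
      rayleigh g φ ≥ K * rayleigh g₀ φ) → ∃ c, ∀ x ∈ (𝓡∂ 2).boundary M, f x = c := by
    intro h
    obtain ⟨x₀, hx₀⟩ := hM
    -- A single test function suffices: being positive, it detects every boundary point at once.
    obtain ⟨φ, hφ, hφpos, hgrad⟩ := exists_pos_gradient_ne_zero g₀ x₀
    have hT : IsTest φ := ⟨hφ, x₀, hx₀, (hφpos x₀).ne'⟩
    refine ⟨-Real.log K, fun x hx => ?_⟩
    rw [← exp_neg_eq_of_rayleigh_ge hfc hg hKle hT ⟨x₀, hgrad⟩ (h φ hT ⟨x₀, hgrad⟩) hx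
      (hφpos x).ne', Real.log_exp, neg_neg]
  refine ⟨fun φ hφ h => le_antisymm (rayleigh_le hfc hg hKle hφ) h,
    fun φ hφ hgrad h x hx hne => exp_neg_eq_of_rayleigh_ge hfc hg hKle hφ hgrad h hx hne,
    hconst, ?_, fun hnc => ?_, fun _ h => le_antisymm (firstSteklov_le hfc hg ?_ hKle) h⟩
  · rintro ⟨c, hc⟩ φ -
    have hKc : K = Real.exp (-c) := by
      have himg : (fun x => Real.exp (-f x)) '' (𝓡∂ 2).boundary M = {Real.exp (-c)} := by
        rw [← hM.image_const (Real.exp (-c))]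
        exact image_congr fun x hx => by rw [hc x hx]
      rw [hK, himg, csSup_singleton]
    rw [hKc]
    exact rayleigh_eq_of_const hfc hg hc φ
  · by_contra! h
    exact hnc (hconst fun φ hφ hgrad => (h φ hφ hgrad).ge)
  · obtain ⟨x, hx⟩ := hM
    exact (Real.exp_pos _).trans_le (hKle x hx)
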